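/- Let $G$ be a locally compact Hausdorff group with a left Haar measure $\sigma$ and let $H$ be a compact subgroup of $G$ with its Haar probability measure $dh$. Let $\mu$ be the $G$-invariant Radon measure on the left coset space $G/H$ normalized by Weil's formula $$\int_{G/H}\Big(\int_H f(xh)\,dh\Big)d\mu(xH)=\int_G f\,d\sigma\qquad(f\in C_c(G)).$$ Let $M(G/H)$ be the space of regular complex Borel measures on $G/H$, and for $\varphi\in L^1(G/H,\mu)$ let $\mu_\varphi\in M(G/H)$ be the measure $\varphi\,d\mu$. For $\varphi,\psi\in C_c(G/H)$ put $$\varphi*_{G/H}\psi(xH)=\int_{G/H}\varphi(yH)\Big(\int_H\psi(hy^{-1}xH)\,dh\Big)d\mu(yH),$$ and write $*_{G/H}$ also for the unique extension of this product to a continuous bilinear map $L^1(G/H,\mu)\times L^1(G/H,\mu)\to L^1(G/H,\mu)$. For $\lambda,\lambda'\in M(G/H)$ let $\lambda*_{G/H}\lambda'\in M(G/H)$ be the unique regular complex measure with $$\int_{G/H}\psi\,d(\lambda*_{G/H}\lambda')=\int_{G/H}\int_{G/H}\Big(\int_H\psi(xhyH)\,dh\Big)d\lambda(xH)\,d\lambda'(yH)\qquad(\psi\in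 C_0(G/H)).$$ Then the extension $*_{G/H}$ to $L^1(G/H,\mu)$ exists and is unique, and for all $\varphi,\varphi'\in L^1(G/H,\mu)$ the measure $\mu_\varphi*_{G/H}\mu_{\varphi'}$ exists, is unique, and satisfies $$\mu_\varphi*_{G/H}\mu_{\varphi'}=\mu_{\varphi*_{G/H}\varphi'}.$$ Since $\varphi\mapsto\mu_\varphi$ is moreover linear, it is an algebra homomorphism from $(L^1(G/H,\mu),*_{G/H})$ to $(M(G/H),*_{G/H})$. -/

import Mathlib

open MeasureTheory MeasureTheory.Measure Set
open scoped ENNReal NNReal CompactlySupported ZeroAtInfty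

noncomputable section

namespace CosetMeasure

/-! ### Regular complex Borel measures -/

section RegularComplex

/-- The total variation of a complex measure is a finite measure. -/
theorem isFiniteMeasure_variation {X : Type*} [MeasurableSpace X] (l : ComplexMeasure X) : IsFiniteMeasure l.variation := by
  refine isFiniteMeasure_of_le
    ((ComplexMeasure.re l).totalVariation + (ComplexMeasure.im l).totalVariation) ?_
  refine VectorMeasure.variation_le_of_forall_enorm_le fun E _ => ?_
  have h1 := SignedMeasure.enorm_le_totalVariation (ComplexMeasure.re l) E
  have h2 := SignedMeasure.enorm_le_totalVariation (ComplexMeasure.im l) E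
  have h3 : ‖l E‖ₑ ≤ ‖(ComplexMeasure.re l) E‖ₑ + ‖(ComplexMeasure.im l) E‖ₑ := by
    have h4 : ‖l E‖ ≤ ‖(ComplexMeasure.re l) E‖ + ‖(ComplexMeasure.im l) E‖ :=
      Complex.norm_le_abs_re_add_abs_im (l E)
    rw [← ofReal_norm, ← ofReal_norm, ← ofReal_norm,
      ← ENNReal.ofReal_add (norm_nonneg _) (norm_nonneg _)]
    exact ENNReal.ofReal_le_ofReal h4
  exact h3.trans (add_le_add h1 h2)

theorem variation_withDensityᵥ_le {X : Type*} [MeasurableSpace X] (μ : Measure X) {f : X → ℂ} (hf : Integrable f μ) :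
    (μ.withDensityᵥ f).variation ≤ μ.withDensity fun x => ‖f x‖ₑ := by
  refine VectorMeasure.variation_le_of_forall_enorm_le fun E hE => ?_
  rw [withDensityᵥ_apply hf hE, withDensity_apply _ hE]
  exact enorm_integral_le_lintegral_enorm _

variable {X : Type*} [TopologicalSpace X] [MeasurableSpace X] [BorelSpace X]

/-- A measure dominated by a finite measure `f • μ`, with `μ` regular, is regular. -/
theorem regular_of_le_withDensity [R1Space X] {μ ν : Measure X} [μ.Regular] {f : X → ℝ≥0∞}
    (hf : AEMeasurable f μ) (hfint : ∫⁻ x, f x ∂μ ≠ ∞) (h : ν ≤ μ.withDensity f) :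
    ν.Regular := by
  rw [withDensity_congr_ae hf.ae_eq_mk] at h
  rw [lintegral_congr_ae hf.ae_eq_mk] at hfint
  have hm : Measurable (hf.mk f) := hf.measurable_mk
  generalize hf.mk f = g at h hfint hm
  have hfin : IsFiniteMeasure (μ.withDensity g) := isFiniteMeasure_withDensity hfint
  have hν : IsFiniteMeasure ν := isFiniteMeasure_of_le _ h
  have key : ν.InnerRegularCompactLTTop := by
    refine ⟨fun A hA r hr => ?_⟩
    let S : ℕ → Set X := fun n => {x | ((n : ℝ≥0∞) + 1)⁻¹ ≤ g x}
    have hSm : ∀ n, MeasurableSet (S n) := fun n => measurableSet_le measurable_const hm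
    have hSmono : Monotone S := by
      intro m n hmn x hx
      refine le_trans ?_ (show ((m : ℝ≥0∞) + 1)⁻¹ ≤ g x from hx)
      exact ENNReal.inv_le_inv.2 (by gcongr)
    have hSunion : ν A ≤ ν (⋃ n, A ∩ S n) := by
      have h0 : ν {x | g x = 0} = 0 := by
        refine le_antisymm ((h _).trans ?_) zero_le
        rw [withDensity_apply _ (measurableSet_eq_fun hm measurable_const)]
        rw [setLIntegral_congr_fun (g := fun _ => 0)
          (measurableSet_eq_fun hm measurable_const) (fun x hx => hx)]
        simp
      refine (measure_mono (t := (⋃ n, A ∩ S n) ∪ {x | g x = 0}) fun x hx => ?_).trans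
        ((measure_union_le _ _).trans (by rw [h0, add_zero]))
      by_cases hgx : g x = 0
      · exact Or.inr hgx
      · left
        obtain ⟨n, hn⟩ := ENNReal.exists_inv_nat_lt hgx
        refine mem_iUnion.2 ⟨n, hx, le_trans ?_ hn.le⟩
        exact ENNReal.inv_le_inv.2 le_self_add
    have hlim := tendsto_measure_iUnion_atTop (μ := ν) (s := fun n => A ∩ S n)
      (fun m n hmn => inter_subset_inter_right A (hSmono hmn))
    obtain ⟨n, hn⟩ := ((hlim.eventually (lt_mem_nhds (hr.trans_le hSunion))).exists)
    have hBm : MeasurableSet (A ∩ S n) := hA.1.inter (hSm n)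
    have hBμ : μ (A ∩ S n) ≠ ∞ := by
      have h1 : μ (S n) < ∞ := (meas_ge_le_lintegral_div hm.aemeasurable (by simp) (by simp)).trans_lt
        (ENNReal.div_lt_top hfint (by simp))
      exact ((measure_mono inter_subset_right).trans_lt h1).ne
    obtain ⟨δ, hδ, hδ'⟩ := exists_pos_setLIntegral_lt_of_measure_lt hfint (tsub_pos_of_lt hn).ne'
    obtain ⟨K, hKA, hK, hKc, hKδ⟩ := hBm.exists_isCompact_isClosed_sdiff_lt hBμ hδ.ne'
    refine ⟨K, hKA.trans inter_subset_left, hK, ?_⟩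
    have h2 : ν ((A ∩ S n) \ K) < ν (A ∩ S n) - r := by
      refine (h _).trans_lt ?_
      rw [withDensity_apply _ (hBm.diff hKc.measurableSet)]
      exact hδ' _ hKδ
    by_contra hcon
    rw [not_lt] at hcon
    have h3 : ν (A ∩ S n) ≤ ν K + ν ((A ∩ S n) \ K) := by
      rw [← measure_union_add_inter K (hBm.diff hKc.measurableSet)]
      exact (measure_mono (by simp)).trans le_self_add
    have h4 : ν (A ∩ S n) < r + (ν (A ∩ S n) - r) :=
      h3.trans_lt (ENNReal.add_lt_add_of_le_of_lt (measure_ne_top ν K) hcon h2)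
    have h5 : r ≤ ν (A ∩ S n) := hn.le
    rw [add_tsub_cancel_of_le h5] at h4
    exact lt_irrefl _ h4
  infer_instance

variable (X) in
/-- `M(X)`: the complex vector space of regular countably additive complex Borel measures. -/
def RegularComplexMeasure [R1Space X] : Submodule ℂ (ComplexMeasure X) where
  carrier := {l | l.variation.Regular}
  zero_mem' := by
    change (VectorMeasure.variation (0 : ComplexMeasure X)).Regular
    rw [VectorMeasure.variation_zero]
    infer_instance
  add_mem' := by
    intro a b (ha : a.variation.Regular) (hb : b.variation.Regular)
    have := isFiniteMeasure_variation a
    have := isFiniteMeasure_variation b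
    refine regular_of_le_withDensity (μ := a.variation + b.variation) (f := 1)
      aemeasurable_one (by simp) ?_
    rw [withDensity_one]
    exact VectorMeasure.variation_add_le
  smul_mem' := by
    intro c a (ha : a.variation.Regular)
    change (c • a).variation.Regular
    rw [VectorMeasure.variation_smul]
    infer_instance

/-- `∫ f dl` for a complex-valued function `f` and a complex measure `l`. -/
def cintegral (l : ComplexMeasure X) (f : X → ℂ) : ℂ :=
  l.integral f (ContinuousLinearMap.mul ℝ ℂ)

/-- For `φ ∈ L¹(X, μ)`, the complex measure `μ_φ = φ dμ`, as an element of `M(X)`. -/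
def densityMeasure [R1Space X] (μ : Measure X) [μ.Regular] (φ : Lp ℂ 1 μ) :
    RegularComplexMeasure X :=
  ⟨μ.withDensityᵥ φ,
    regular_of_le_withDensity (L1.integrable_coeFn φ).1.enorm
      (L1.integrable_coeFn φ).2.ne (variation_withDensityᵥ_le μ (L1.integrable_coeFn φ))⟩

end RegularComplex

/-! ### Convolutions on `G ⧸ H` -/

section Coset

variable {G : Type*} [Group G] [TopologicalSpace G] [IsTopologicalGroup G]
  [MeasurableSpace G] [BorelSpace G] (H : Subgroup G) [CompactSpace H]

/-- The Haar probability measure `dh` of the compact group `H`. -/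
def haarProb : Measure H := haarMeasure ⊤

instance : (haarProb H).IsHaarMeasure := by unfold haarProb; infer_instance

instance : IsProbabilityMeasure (haarProb H) := ⟨haarMeasure_self⟩

instance : (haarProb H).IsMulRightInvariant := by
  refine ⟨fun g => ?_⟩
  have : IsProbabilityMeasure (map (· * g) (haarProb H)) :=
    isProbabilityMeasure_map (by fun_prop)
  exact isHaarMeasure_eq_of_isProbabilityMeasure _ _

/-- `T_H f (xH) = ∫_H f(xh) dh`. -/
def cosetAverage (f : G → ℂ) (x : G ⧸ H) : ℂ :=
  Quotient.liftOn' x (fun g => ∫ h : H, f (g * h) ∂(haarProb H)) <| by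
    intro a b hab
    obtain ⟨k, rfl⟩ : ∃ k : H, b = a * k :=
      ⟨⟨a⁻¹ * b, QuotientGroup.leftRel_apply.1 hab⟩, by simp⟩
    have := integral_mul_left_eq_self (μ := haarProb H) (fun h : H => f (a * h)) k
    simpa [mul_assoc] using this.symm

/-- `J ψ (xH) = ∫_H ψ(hxH) dh`. -/
def leftAverage (ψ : G ⧸ H → ℂ) (x : G ⧸ H) : ℂ :=
  ∫ h : H, ψ ((h : G) • x) ∂(haarProb H)

theorem leftAverage_smul (ψ : G ⧸ H → ℂ) (k : H) (x : G ⧸ H) :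
    leftAverage H ψ ((k : G) • x) = leftAverage H ψ x := by
  have := integral_mul_right_eq_self (μ := haarProb H) (fun h : H => ψ ((h : G) • x)) k
  simpa [leftAverage, mul_smul] using this

/-- `J ψ (y⁻¹xH)` as a function of the cosets `yH` and `xH`. -/
def leftAverageDiv (ψ : G ⧸ H → ℂ) (y x : G ⧸ H) : ℂ :=
  Quotient.liftOn' y (fun g => leftAverage H ψ (g⁻¹ • x)) <| by
    intro a b hab
    obtain ⟨k, rfl⟩ : ∃ k : H, b = a * k :=
      ⟨⟨a⁻¹ * b, QuotientGroup.leftRel_apply.1 hab⟩, by simp⟩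
    have := leftAverage_smul H ψ k⁻¹ (a⁻¹ • x)
    simpa [mul_smul] using this.symm

/-- `∫_H ψ(xhyH) dh` as a function of the cosets `xH` and `yH`. -/
def cosetKernel (ψ : G ⧸ H → ℂ) (x y : G ⧸ H) : ℂ :=
  Quotient.liftOn' x (fun g => ∫ h : H, ψ ((g * h) • y) ∂(haarProb H)) <| by
    intro a b hab
    obtain ⟨k, rfl⟩ : ∃ k : H, b = a * k :=
      ⟨⟨a⁻¹ * b, QuotientGroup.leftRel_apply.1 hab⟩, by simp⟩
    have := integral_mul_left_eq_self (μ := haarProb H) (fun h : H => ψ ((a * h) • y)) k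
    simpa [mul_assoc] using this.symm

instance [T2Space G] : T2Space (G ⧸ H) := by
  have : IsClosed (H : Set G) := (isCompact_iff_compactSpace.2 ‹CompactSpace H›).isClosed
  infer_instance

variable [MeasurableSpace (G ⧸ H)] [BorelSpace (G ⧸ H)]

/-- The convolution `(φ * ψ)(xH) = ∫_{G/H} φ(yH) J ψ(y⁻¹xH) dμ(yH)`. -/
def cosetConv (μ : Measure (G ⧸ H)) (φ ψ : G ⧸ H → ℂ) (x : G ⧸ H) : ℂ :=
  ∫ y, φ y * leftAverageDiv H ψ y x ∂μ

/-- `B` is a continuous bilinear map on `L¹(G/H, μ)` that extends the convolution of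
`C_c(G/H)`. -/
def ExtendsConv (μ : Measure (G ⧸ H)) (B : Lp ℂ 1 μ →L[ℂ] Lp ℂ 1 μ →L[ℂ] Lp ℂ 1 μ) : Prop :=
  ∀ (f g : C_c(G ⧸ H, ℂ)) (φ ψ : Lp ℂ 1 μ), φ =ᵐ[μ] f → ψ =ᵐ[μ] g →
    B φ ψ =ᵐ[μ] cosetConv H μ f g

open Classical in
/-- The convolution of `L¹(G/H, μ)`: the unique continuous bilinear extension of the convolution
of `C_c(G/H)`. -/
def l1Conv (μ : Measure (G ⧸ H)) : Lp ℂ 1 μ →L[ℂ] Lp ℂ 1 μ →L[ℂ] Lp ℂ 1 μ :=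
  if h : ∃ B, ExtendsConv H μ B then h.choose else 0

variable [T2Space G]

/-- `n` represents the functional
`ψ ↦ ∫_{G/H} ∫_{G/H} (∫_H ψ(xhyH) dh) dl(xH) dl'(yH)` on `C₀(G/H)`. -/
def IsMeasureConv (l l' n : RegularComplexMeasure (G ⧸ H)) : Prop :=
  ∀ ψ : C₀(G ⧸ H, ℂ), cintegral n.1 ψ =
    cintegral l'.1 fun y => cintegral l.1 fun x => cosetKernel H ψ x y

open Classical in
/-- The convolution of `M(G/H)`: the unique regular complex measure that represents the functional
in `IsMeasureConv`. -/
def measureConv (l l' : RegularComplexMeasure (G ⧸ H)) : RegularComplexMeasure (G ⧸ H) :=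
  if h : ∃ n, IsMeasureConv H l l' n then h.choose else 0

end Coset

end CosetMeasure

end

open CosetMeasure

/-! For `f`, `g` in `C_c(G/H)` and `ψ` continuous, the identity ∫ (f * g) ψ dμ = ∫ g(y) ∫ f(x) (∫_H
ψ(xhyH) dh) dμ(x) dμ(y) is Fubini followed by translations: invariance of `μ` under `G` and of `dh`
under inversion moves the average over `H` from `g` to `ψ` (`integral_leftAverage_mul`,
`integral_cosetConv_mul`). This is the claim for densities in `C_c`.

The rest is density of `C_c` in `L¹`. The bound ‖f * g‖₁ ≤ ‖f‖₁ ‖g‖₁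
(`norm_compactlySupportedConv_le`) extends the product uniquely. For fixed `ψ` in `C₀` both sides of
the identity are continuous bilinear forms on `L¹`, the right one because |∫_H ψ(xhyH) dh| ≤ ‖ψ‖;
hence it persists on `L¹` (`isMeasureConv_densityMeasure`). A regular complex measure is determined
by its integrals of `C₀` functions (`regularComplexMeasure_ext`), which makes the representing
measure unique.

As `μ` need not be σ-finite, Fubini is applied only to continuous functions of compact support. -/

open Filter Topology
open scoped BoundedContinuousFunction

noncomputable section

namespace CosetMeasure

/-! ### Density of `C_c` in `L¹` and extension of bilinear maps -/

section Approximation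

/-- The two functions agree on `s` and both vanish off `V ∪ t`; elsewhere both values lie on the
segment from `0` to `c`. -/
theorem norm_ofReal_mul_sub_indicator_le {X : Type*} {g : X → ℝ} (hg : ∀ x, g x ∈ Icc (0 : ℝ) 1)
    (c : ℂ) {s t V : Set X} (hst : s ⊆ t) (hs : EqOn g 1 s) (hV : EqOn g 0 Vᶜ) (x : X) :
    ‖(g x : ℂ) * c - t.indicator (fun _ => c) x‖ ≤
      ‖((V \ s) ∪ (t \ s)).indicator (fun _ => c) x‖ := by
  have hgx := hg x
  have hcn : ‖(g x : ℂ) * c‖ ≤ ‖c‖ := by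
    rw [norm_mul, Complex.norm_real, Real.norm_of_nonneg hgx.1]
    exact mul_le_of_le_one_left (norm_nonneg _) hgx.2
  have hcn' : ‖(g x : ℂ) * c - c‖ ≤ ‖c‖ := by
    rw [← sub_one_mul, norm_mul, ← Complex.ofReal_one, ← Complex.ofReal_sub,
      Complex.norm_real, Real.norm_of_nonpos (by linarith [hgx.2])]
    exact mul_le_of_le_one_left (norm_nonneg _) (by linarith [hgx.1])
  by_cases hxs : x ∈ s
  · simp [hst hxs, hs hxs, hxs]
  · by_cases hxt : x ∈ t
    · simpa [hxs, hxt] using hcn'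
    · by_cases hxV : x ∈ V
      · simpa [hxs, hxt, hxV] using hcn
      · simp [hxs, hxt, hxV, hV hxV]

variable {X : Type*} [TopologicalSpace X] [MeasurableSpace X] [BorelSpace X]
  (μ : Measure X)

/-- The canonical linear map `C_c(X) → L¹(X, μ)`. -/
def compactlySupportedToL1 [IsFiniteMeasureOnCompacts μ] : C_c(X, ℂ) →ₗ[ℂ] Lp ℂ 1 μ where
  toFun f := (f.integrable (μ := μ)).toL1 f
  map_add' _ _ := rfl
  map_smul' _ _ := rfl

theorem coeFn_compactlySupportedToL1 [IsFiniteMeasureOnCompacts μ] (f : C_c(X, ℂ)) :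
    compactlySupportedToL1 μ f =ᵐ[μ] f :=
  (f.integrable (μ := μ)).coeFn_toL1

theorem norm_compactlySupportedToL1 [IsFiniteMeasureOnCompacts μ] (f : C_c(X, ℂ)) :
    ‖compactlySupportedToL1 μ f‖ = ∫ x, ‖f x‖ ∂μ := by
  rw [L1.norm_eq_integral_norm]
  exact integral_congr_ae ((coeFn_compactlySupportedToL1 μ f).mono fun x hx => by simp only [hx])

theorem exists_hasCompactSupport_eLpNorm_sub_indicator_le [R1Space X] [LocallyCompactSpace X]
    [μ.Regular] (c : ℂ) {t : Set X} (ht : MeasurableSet t) (htμ : μ t < ∞) {δ : ℝ≥0∞}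
    (hδ : δ ≠ 0) :
    ∃ g : X → ℂ, eLpNorm (g - t.indicator fun _ => c) 1 μ ≤ δ ∧ Continuous g ∧
      HasCompactSupport g := by
  -- The error lives on `V \ s` and `t \ s`, each of measure below `η`. The open set `V` only has to
  -- surround the compact set `s`, not `t`.
  obtain ⟨η, hη, hηδ⟩ : ∃ η : ℝ≥0∞, η ≠ 0 ∧ ‖c‖ₑ * (η + η) ≤ δ := by
    obtain ⟨η, hη, hηδ⟩ :=
      ENNReal.exists_nnreal_pos_mul_lt (a := ‖c‖ₑ * 2) (by finiteness) hδ
    refine ⟨η, by simpa using hη.ne', le_of_eq_of_le ?_ hηδ.le⟩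
    ring
  obtain ⟨s, hst, hs, hsc, hsη⟩ := ht.exists_isCompact_isClosed_sdiff_lt htμ.ne hη
  obtain ⟨V, hsV, hV, -, hVη⟩ :=
    hsc.measurableSet.exists_isOpen_sdiff_lt ((measure_mono hst).trans_lt htμ).ne hη
  obtain ⟨g, hg1, hg0, hgc, hgr⟩ := exists_continuous_one_zero_of_isCompact hs hV.isClosed_compl
    (disjoint_compl_right_iff_subset.2 hsV)
  refine ⟨fun x => g x * c, ?_, by fun_prop, HasCompactSupport.intro hgc fun x hx => by
    simp [image_eq_zero_of_notMem_tsupport hx]⟩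
  calc eLpNorm ((fun x => (g x : ℂ) * c) - t.indicator fun _ => c) 1 μ
      ≤ eLpNorm (((V \ s) ∪ (t \ s)).indicator fun _ => c) 1 μ :=
        eLpNorm_mono fun x => norm_ofReal_mul_sub_indicator_le hgr c hst hg1 hg0 x
    _ ≤ ‖c‖ₑ * μ ((V \ s) ∪ (t \ s)) := by
        rw [eLpNorm_indicator_const ((hV.measurableSet.diff hsc.measurableSet).union
          (ht.diff hsc.measurableSet)) one_ne_zero ENNReal.one_ne_top]
        simp
    _ ≤ ‖c‖ₑ * (η + η) := by
        gcongr
        exact (measure_union_le _ _).trans (add_le_add hVη.le hsη.le)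
    _ ≤ δ := hηδ

/-- Integrable functions on a locally compact space are approximated in `L¹` by continuous functions
of compact support. -/
theorem exists_hasCompactSupport_integral_norm_sub_le [R1Space X] [LocallyCompactSpace X]
    [μ.Regular] {φ : X → ℂ} (hφ : Integrable φ μ) {ε : ℝ} (hε : 0 < ε) :
    ∃ g : X → ℂ, HasCompactSupport g ∧ ∫ x, ‖φ x - g x‖ ∂μ ≤ ε ∧ Continuous g ∧ Integrable g μ := by
  obtain ⟨g, hg, hgc, hgs⟩ := (memLp_one_iff_integrable.2 hφ).induction_dense ENNReal.one_ne_top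
    (fun g => Continuous g ∧ HasCompactSupport g)
    (fun c t ht htμ δ hδ => exists_hasCompactSupport_eLpNorm_sub_indicator_le μ c ht htμ hδ)
    (fun f g hf hg => ⟨hf.1.add hg.1, hf.2.add hg.2⟩)
    (fun f hf => (hf.1.integrable_of_hasCompactSupport hf.2).1)
    (ε := ENNReal.ofReal ε) (by simpa using hε)
  have hgi : Integrable g μ := hgc.integrable_of_hasCompactSupport hgs
  refine ⟨g, hgs, ?_, hgc, hgi⟩
  rw [eLpNorm_one_eq_lintegral_enorm] at hg
  refine (integral_norm_eq_lintegral_enorm (hφ.sub hgi).1).trans_le ?_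
  exact ENNReal.toReal_le_of_le_ofReal hε.le hg

theorem denseRange_compactlySupportedToL1 [R1Space X] [LocallyCompactSpace X] [μ.Regular] :
    DenseRange (compactlySupportedToL1 μ) := by
  intro φ
  rw [Metric.mem_closure_iff]
  intro ε hε
  obtain ⟨g, hgs, hg, hgc, -⟩ :=
    exists_hasCompactSupport_integral_norm_sub_le μ (L1.integrable_coeFn φ) (half_pos hε)
  refine ⟨_, ⟨⟨⟨g, hgc⟩, hgs⟩, rfl⟩, ?_⟩
  rw [dist_eq_norm, L1.norm_eq_integral_norm]
  refine lt_of_le_of_lt (le_of_eq_of_le (integral_congr_ae ?_) hg) (half_lt_self hε)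
  filter_upwards [Lp.coeFn_sub φ (compactlySupportedToL1 μ ⟨⟨g, hgc⟩, hgs⟩),
    coeFn_compactlySupportedToL1 μ ⟨⟨g, hgc⟩, hgs⟩] with x h1 h2
  rw [h1, Pi.sub_apply, h2]
  rfl

variable [R1Space X] [LocallyCompactSpace X] [μ.Regular]
  {F : Type*} [NormedAddCommGroup F] [NormedSpace ℂ F]

variable {μ} in
/-- Continuous bilinear maps on `L¹` are determined by their values on `C_c`. -/
theorem bilinear_ext {B B' : Lp ℂ 1 μ →L[ℂ] Lp ℂ 1 μ →L[ℂ] F}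
    (h : ∀ f g, B (compactlySupportedToL1 μ f) (compactlySupportedToL1 μ g) =
      B' (compactlySupportedToL1 μ f) (compactlySupportedToL1 μ g)) : B = B' := by
  have hd := denseRange_compactlySupportedToL1 μ
  refine DFunLike.coe_injective (hd.equalizer B.continuous B'.continuous (funext fun f => ?_))
  exact DFunLike.coe_injective
    (hd.equalizer (ContinuousLinearMap.continuous _) (ContinuousLinearMap.continuous _)
      (funext fun g => h f g))

/-- A bilinear map on `C_c` that is bounded for the `L¹` norms extends to `L¹`. -/
theorem exists_bilinear_extension [CompleteSpace F] (b : C_c(X, ℂ) →ₗ[ℂ] C_c(X, ℂ) →ₗ[ℂ] F)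
    (hb : ∀ f g, ‖b f g‖ ≤ ‖compactlySupportedToL1 μ f‖ * ‖compactlySupportedToL1 μ g‖) :
    ∃ B : Lp ℂ 1 μ →L[ℂ] Lp ℂ 1 μ →L[ℂ] F,
      ∀ f g, B (compactlySupportedToL1 μ f) (compactlySupportedToL1 μ g) = b f g := by
  have hd := denseRange_compactlySupportedToL1 μ
  let e := compactlySupportedToL1 μ
  -- One variable at a time: each `b f` extends to `L¹`. By density the extension is linear in `f`,
  -- and its operator norm is at most `‖e f‖`, so the map `T` extends in turn.
  have hT : ∀ f g, (b f).extendOfNorm e (e g) = b f g := fun f g =>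
    LinearMap.extendOfNorm_eq hd ⟨_, hb f⟩ g
  have hext : ∀ S T : Lp ℂ 1 μ →L[ℂ] F, (∀ g, S (e g) = T (e g)) → S = T := fun S T h =>
    DFunLike.coe_injective (hd.equalizer S.continuous T.continuous (funext h))
  let T : C_c(X, ℂ) →ₗ[ℂ] Lp ℂ 1 μ →L[ℂ] F :=
    { toFun f := (b f).extendOfNorm e
      map_add' f f' := hext _ _ fun g => by
        change _ = (b f).extendOfNorm e (e g) + (b f').extendOfNorm e (e g)
        rw [hT, hT, hT, map_add, LinearMap.add_apply]
      map_smul' c f := hext _ _ fun g => by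
        change _ = c • (b f).extendOfNorm e (e g)
        rw [hT, hT, map_smul, LinearMap.smul_apply] }
  have hTn : ∀ f, ‖T f‖ ≤ 1 * ‖e f‖ := fun f => by
    rw [one_mul]
    exact LinearMap.opNorm_extendOfNorm_le hd (norm_nonneg _) (hb f)
  refine ⟨T.extendOfNorm e, fun f g => ?_⟩
  rw [LinearMap.extendOfNorm_eq hd ⟨_, hTn⟩ f]
  exact hT f g

end Approximation

/-! ### Pairing of bounded continuous functions with `L¹` -/

section Pairing

variable {X : Type*} [TopologicalSpace X] [MeasurableSpace X] [BorelSpace X] (μ : Measure X)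

theorem integrable_mul_boundedContinuous {φ : X → ℂ} (hφ : Integrable φ μ) (F : X →ᵇ ℂ) :
    Integrable (fun x => φ x * F x) μ :=
  hφ.mul_bdd F.continuous.aestronglyMeasurable (ae_of_all _ F.norm_coe_le_norm)

/-- The pairing `(F, φ) ↦ ∫ φ F dμ` of bounded continuous and integrable functions. -/
def boundedPairing : (X →ᵇ ℂ) →L[ℂ] Lp ℂ 1 μ →L[ℂ] ℂ :=
  (LinearMap.mk₂ ℂ (fun (F : X →ᵇ ℂ) (φ : Lp ℂ 1 μ) => ∫ x, φ x * F x ∂μ)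
    (fun F F' φ => by
      rw [← integral_add (integrable_mul_boundedContinuous μ (L1.integrable_coeFn φ) F)
        (integrable_mul_boundedContinuous μ (L1.integrable_coeFn φ) F')]
      simp [mul_add])
    (fun c F φ => by
      rw [← integral_smul]
      simp [mul_left_comm])
    (fun F φ φ' => by
      rw [← integral_add (integrable_mul_boundedContinuous μ (L1.integrable_coeFn φ) F)
        (integrable_mul_boundedContinuous μ (L1.integrable_coeFn φ') F)]
      refine integral_congr_ae ((Lp.coeFn_add φ φ').mono fun x hx => ?_)
      simp only [hx, Pi.add_apply, add_mul])
    (fun c F φ => by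
      rw [← integral_smul]
      refine integral_congr_ae ((Lp.coeFn_smul c φ).mono fun x hx => ?_)
      simp only [hx, Pi.smul_apply, smul_eq_mul, mul_assoc])).mkContinuous₂ 1 fun F φ => by
    rw [LinearMap.mk₂_apply, one_mul, L1.norm_eq_integral_norm, ← integral_const_mul]
    refine norm_integral_le_of_norm_le ((L1.integrable_coeFn φ).norm.const_mul _)
      (ae_of_all _ fun x => ?_)
    rw [norm_mul, mul_comm]
    gcongr
    exact F.norm_coe_le_norm x

theorem boundedPairing_compactlySupportedToL1 [IsFiniteMeasureOnCompacts μ] (F : X →ᵇ ℂ)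
    (f : C_c(X, ℂ)) : boundedPairing μ F (compactlySupportedToL1 μ f) = ∫ x, f x * F x ∂μ :=
  integral_congr_ae ((coeFn_compactlySupportedToL1 μ f).mono fun x hx => by simp only [hx])

end Pairing

/-! ### Integration against complex measures -/

section Cintegral

variable {X : Type*} [MeasurableSpace X]

theorem cintegral_indicator_const (l : ComplexMeasure X) (c : ℂ) {s : Set X}
    (hs : MeasurableSet s) : l.integral (s.indicator fun _ => c) (ContinuousLinearMap.mul ℝ ℂ) =
      c * l s := by
  have := isFiniteMeasure_variation l
  exact VectorMeasure.integral_indicator_const c hs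

variable [TopologicalSpace X] [BorelSpace X]

/-- Integration of bounded functions against a measure with density. -/
theorem cintegral_withDensityᵥ {μ : Measure X} {φ : X → ℂ} (hφ : Integrable φ μ) (F : X →ᵇ ℂ) :
    cintegral (μ.withDensityᵥ φ) F = ∫ x, φ x * F x ∂μ := by
  have hfin := isFiniteMeasure_variation (μ.withDensityᵥ φ)
  have hsimple : ∀ f : SimpleFunc X ℂ,
      cintegral (μ.withDensityᵥ φ) f = ∫ x, φ x * f x ∂μ := by
    intro f
    induction f using SimpleFunc.induction with
    | @const c s hs =>
      have h : ⇑(SimpleFunc.piecewise s hs (SimpleFunc.const X c) (SimpleFunc.const X 0)) =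
          s.indicator fun _ => c := by
        ext x
        simp only [SimpleFunc.coe_piecewise, Set.piecewise, SimpleFunc.const_apply, indicator]
      rw [h, cintegral, cintegral_indicator_const _ _ hs, withDensityᵥ_apply hφ hs,
        ← integral_const_mul, ← integral_indicator hs]
      refine integral_congr_ae (ae_of_all _ fun x => ?_)
      by_cases hx : x ∈ s <;> simp [hx, mul_comm]
    | @add f g hd hf hg =>
      have hi : ∀ f : SimpleFunc X ℂ, Integrable (fun x => φ x * f x) μ := fun f => by
        obtain ⟨C, hC⟩ := f.exists_forall_norm_le
        exact hφ.mul_bdd f.aestronglyMeasurable (ae_of_all _ hC)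
      rw [SimpleFunc.coe_add, cintegral, VectorMeasure.integral_add
        (f.integrable_of_isFiniteMeasure) (g.integrable_of_isFiniteMeasure)]
      rw [cintegral] at hf hg
      rw [hf, hg, ← integral_add (hi f) (hi g)]
      simp [mul_add]
  have hF : StronglyMeasurable F := F.continuous.measurable.stronglyMeasurable
  have hlim := fun x => hF.tendsto_approxBounded_of_norm_le (F.norm_coe_le_norm x)
  have hbd := fun n x => hF.norm_approxBounded_le (norm_nonneg F) n x
  -- Simple functions bounded by `‖F‖` converge to `F` pointwise. Dominated convergence applies on
  -- both sides, with the constant `‖F‖` for the finite variation and with `‖φ‖ ‖F‖` for `μ`.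
  have h1 := VectorMeasure.tendsto_integral_of_dominated_convergence (μ := μ.withDensityᵥ φ)
    (B := ContinuousLinearMap.mul ℝ ℂ) (fun _ => ‖F‖)
    (fun n => (hF.approxBounded ‖F‖ n).aestronglyMeasurable) (integrable_const _)
    (fun n => ae_of_all _ (hbd n)) (ae_of_all _ hlim)
  have h2 := tendsto_integral_of_dominated_convergence (μ := μ)
    (F := fun n x => φ x * hF.approxBounded ‖F‖ n x) (f := fun x => φ x * F x)
    (fun x => ‖φ x‖ * ‖F‖)
    (fun n => hφ.1.mul (hF.approxBounded ‖F‖ n).aestronglyMeasurable) (hφ.norm.mul_const _)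
    (fun n => ae_of_all _ fun x => by rw [norm_mul]; gcongr; exact hbd n x)
    (ae_of_all _ fun x => (hlim x).const_mul _)
  exact tendsto_nhds_unique (h1.congr fun n => hsimple _) h2

/-- A regular complex measure is determined by the integrals of `C₀` functions. -/
theorem regularComplexMeasure_ext [R1Space X] [LocallyCompactSpace X]
    {n n' : RegularComplexMeasure X}
    (h : ∀ ψ : C₀(X, ℂ), cintegral n.1 ψ = cintegral n'.1 ψ) : n = n' := by
  have := isFiniteMeasure_variation n.1
  have := isFiniteMeasure_variation n'.1
  have : n.1.variation.Regular := n.2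
  have : n'.1.variation.Regular := n'.2
  -- One regular measure dominates both variations, so a single `g` in `C_c` close to the indicator
  -- of `s` in `L¹(ν)` approximates `n s` and `n' s` simultaneously.
  set ν := n.1.variation + n'.1.variation with hν
  refine Subtype.ext (VectorMeasure.ext fun s hs => ?_)
  have hint : Integrable (s.indicator fun _ => (1 : ℂ)) ν := (integrable_const 1).indicator hs
  have key : ∀ (m : RegularComplexMeasure X), m.1.variation ≤ ν → ∀ ε > 0, ∀ g : X → ℂ,
      Integrable g ν → ∫ x, ‖s.indicator (fun _ => (1 : ℂ)) x - g x‖ ∂ν ≤ ε →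
      ‖m.1 s - cintegral m.1 g‖ ≤ ε := by
    intro m hm ε hε g hg hle
    have h1 : m.1 s = m.1.integral (s.indicator fun _ => (1 : ℂ)) (ContinuousLinearMap.mul ℝ ℂ) := by
      rw [cintegral_indicator_const _ _ hs, one_mul]
    rw [h1, cintegral, ← VectorMeasure.integral_sub (hint.mono_measure hm) (hg.mono_measure hm)]
    refine VectorMeasure.norm_integral_le_integral_norm.trans (le_trans ?_ hle)
    rw [ContinuousLinearMap.opNorm_mul, one_mul]
    exact integral_mono_measure hm (ae_of_all _ fun _ => norm_nonneg _) (hint.sub hg).norm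
  rw [← sub_eq_zero, ← norm_eq_zero]
  refine le_antisymm (le_of_forall_pos_le_add fun ε hε => ?_) (norm_nonneg _)
  obtain ⟨g, hgs, hgle, hgc, hgi⟩ :=
    exists_hasCompactSupport_integral_norm_sub_le ν hint (half_pos hε)
  have e1 := key n (Measure.le_add_right le_rfl) _ (half_pos hε) g hgi hgle
  have e2 := key n' (Measure.le_add_left le_rfl) _ (half_pos hε) g hgi hgle
  have e3 : cintegral n.1 g = cintegral n'.1 g :=
    h ⟨⟨g, hgc⟩, by simpa using hgs.is_zero_at_infty⟩
  rw [e3] at e1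
  calc ‖n.1 s - n'.1 s‖ = ‖(n.1 s - cintegral n'.1 g) - (n'.1 s - cintegral n'.1 g)‖ := by
        congr 1; ring
    _ ≤ ε / 2 + ε / 2 := (norm_sub_le _ _).trans (add_le_add e1 e2)
    _ = 0 + ε := by ring

end Cintegral

/-- `φ ↦ φ dμ` is linear. -/
theorem isLinearMap_densityMeasure {X : Type*} [TopologicalSpace X] [MeasurableSpace X]
    [BorelSpace X] [R1Space X] (μ : Measure X) [μ.Regular] :
    IsLinearMap ℂ fun φ : Lp ℂ 1 μ => densityMeasure μ φ where
  map_add φ φ' := Subtype.ext <| by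
    change μ.withDensityᵥ _ = μ.withDensityᵥ _ + μ.withDensityᵥ _
    rw [← withDensityᵥ_add (L1.integrable_coeFn φ) (L1.integrable_coeFn φ')]
    exact WithDensityᵥEq.congr_ae (Lp.coeFn_add φ φ')
  map_smul c φ := Subtype.ext <| by
    change μ.withDensityᵥ _ = c • μ.withDensityᵥ _
    rw [← withDensityᵥ_smul]
    exact WithDensityᵥEq.congr_ae (Lp.coeFn_smul c φ)


/-! ### Averages over `H`: continuity and supports -/

section CosetFunctions

variable {G : Type*} [Group G] [TopologicalSpace G] [IsTopologicalGroup G]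
  {H : Subgroup G} [CompactSpace H]

/-- Since `H` is compact, the projection is closed, and its fibres `aH` are compact; so it is
proper. -/
theorem isCompact_preimage_mk {K : Set (G ⧸ H)} (hK : IsCompact K) :
    IsCompact ((QuotientGroup.mk : G → G ⧸ H) ⁻¹' K) := by
  have hH : IsCompact (H : Set G) := isCompact_iff_compactSpace.2 ‹CompactSpace H›
  have hp : IsProperMap (QuotientGroup.mk : G → G ⧸ H) := by
    refine isProperMap_iff_isClosedMap_and_compact_fibers.2
      ⟨QuotientGroup.continuous_mk, QuotientGroup.isClosedMap_coe hH, fun y => ?_⟩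
    induction y using QuotientGroup.induction_on with
    | H a =>
      convert hH.image (continuous_const_mul a) using 1
      ext b
      simp only [mem_preimage, mem_singleton_iff, mem_image, SetLike.mem_coe]
      rw [eq_comm, QuotientGroup.eq]
      exact ⟨fun h => ⟨_, h, by simp⟩, by rintro ⟨k, hk, rfl⟩; simpa using hk⟩
  exact hp.isCompact_preimage hK

/-- If `g(hx) ≠ 0` then `x = h⁻¹(hx)` lies in `H · supp g`, a continuous image of a compact product.
-/
theorem exists_isCompact_leftAverage_eq_zero {g : G ⧸ H → ℂ} (hg : HasCompactSupport g) :
    ∃ M, IsCompact M ∧ ∀ x ∉ M, ∀ h : H, g ((h : G) • x) = 0 := by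
  have hH : IsCompact (H : Set G) := isCompact_iff_compactSpace.2 ‹CompactSpace H›
  refine ⟨(fun p : G × (G ⧸ H) => p.1 • p.2) '' ((H : Set G) ×ˢ tsupport g),
    (hH.prod hg).image (by fun_prop), fun x hx h => ?_⟩
  by_contra hne
  exact hx ⟨(((h⁻¹ : H) : G), (h : G) • x), ⟨(h⁻¹).2, subset_tsupport _ hne⟩, by simp⟩

variable [MeasurableSpace G] [BorelSpace G]

/-- As `dh` is also right invariant, its image under inversion is a left Haar probability measure,
and there is only one. -/
instance : (haarProb H).IsInvInvariant := by
  refine ⟨?_⟩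
  have : IsProbabilityMeasure (haarProb H).inv := isProbabilityMeasure_map (by fun_prop)
  have : (haarProb H).inv.IsHaarMeasure := by
    have : (haarProb H).inv.IsOpenPosMeasure :=
      continuous_inv.isOpenPosMeasure_map inv_surjective
    exact {}
  exact isHaarMeasure_eq_of_isProbabilityMeasure _ _

theorem continuous_integral_haarProb {Y : Type*} [TopologicalSpace Y] {F : Y → H → ℂ}
    (hF : Continuous F.uncurry) : Continuous fun y => ∫ h, F y h ∂(haarProb H) := by
  rw [← continuousOn_univ]
  exact continuousOn_integral_of_compact_support isCompact_univ hF.continuousOn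
    fun _ _ _ h => (h (mem_univ _)).elim

theorem norm_integral_haarProb_le {F : H → ℂ} {C : ℝ} (hF : ∀ h, ‖F h‖ ≤ C) :
    ‖∫ h, F h ∂(haarProb H)‖ ≤ C := by
  simpa using norm_integral_le_of_norm_le_const (μ := haarProb H) (ae_of_all _ hF)

theorem leftAverageDiv_mk (ψ : G ⧸ H → ℂ) (a : G) (x : G ⧸ H) :
    leftAverageDiv H ψ a x = leftAverage H ψ (a⁻¹ • x) := rfl

theorem cosetKernel_mk (ψ : G ⧸ H → ℂ) (a : G) (y : G ⧸ H) :
    cosetKernel H ψ a y = ∫ h : H, ψ ((a * h) • y) ∂(haarProb H) := rfl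

theorem continuous_leftAverage {ψ : G ⧸ H → ℂ} (hψ : Continuous ψ) :
    Continuous (leftAverage H ψ) :=
  continuous_integral_haarProb (F := fun x (h : H) => ψ ((h : G) • x)) (by
    unfold Function.uncurry; fun_prop)

/-- The projection is an open quotient map, and so is its product with the identity of `G/H`.
Continuity can therefore be tested on `G × G/H`, where the function is explicit. -/
theorem continuous_leftAverageDiv {ψ : G ⧸ H → ℂ} (hψ : Continuous ψ) :
    Continuous fun p : (G ⧸ H) × (G ⧸ H) => leftAverageDiv H ψ p.1 p.2 := by
  rw [← (QuotientGroup.isOpenQuotientMap_mk.prodMap IsOpenQuotientMap.id).continuous_comp_iff]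
  change Continuous fun p : G × (G ⧸ H) => leftAverage H ψ (p.1⁻¹ • p.2)
  exact (continuous_leftAverage hψ).comp (by fun_prop)

theorem continuous_cosetKernel {ψ : G ⧸ H → ℂ} (hψ : Continuous ψ) :
    Continuous fun p : (G ⧸ H) × (G ⧸ H) => cosetKernel H ψ p.1 p.2 := by
  rw [← (QuotientGroup.isOpenQuotientMap_mk.prodMap IsOpenQuotientMap.id).continuous_comp_iff]
  exact continuous_integral_haarProb
    (F := fun (p : G × (G ⧸ H)) (h : H) => ψ ((p.1 * h) • p.2)) (by
      unfold Function.uncurry; fun_prop)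

theorem norm_cosetKernel_le {ψ : G ⧸ H → ℂ} {C : ℝ} (hψ : ∀ x, ‖ψ x‖ ≤ C) (x y : G ⧸ H) :
    ‖cosetKernel H ψ x y‖ ≤ C := by
  induction x using QuotientGroup.induction_on with
  | H a => exact norm_integral_haarProb_le fun h => hψ _

/-- As `y` ranges over a compact set, the functions `x ↦ J g(y⁻¹x)` are supported in a common
compact set. -/
theorem exists_isCompact_leftAverageDiv_eq_zero {g : G ⧸ H → ℂ} (hg : HasCompactSupport g)
    {K : Set (G ⧸ H)} (hK : IsCompact K) :
    ∃ M, IsCompact M ∧ ∀ y ∈ K, ∀ x ∉ M, leftAverageDiv H g y x = 0 := by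
  obtain ⟨L, hL, hLg⟩ := exists_isCompact_leftAverage_eq_zero hg
  -- With `L` carrying the support of `J g`, the function for `y = aH` lives on `aL`; all these sets
  -- lie in the product of the compact preimage of `K` with `L`.
  refine ⟨(fun p : G × (G ⧸ H) => p.1 • p.2) '' (((QuotientGroup.mk : G → G ⧸ H) ⁻¹' K) ×ˢ L),
    ((isCompact_preimage_mk hK).prod hL).image (by fun_prop), fun y hy x hx => ?_⟩
  induction y using QuotientGroup.induction_on with
  | H a =>
    rw [leftAverageDiv_mk, leftAverage]
    have : a⁻¹ • x ∉ L := fun h => hx ⟨(a, a⁻¹ • x), ⟨hy, h⟩, by simp⟩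
    simp [hLg _ this]

theorem leftAverage_add {f g : G ⧸ H → ℂ} (hf : Continuous f) (hg : Continuous g) :
    leftAverage H (f + g) = leftAverage H f + leftAverage H g := by
  have h : ∀ {u : G ⧸ H → ℂ}, Continuous u → ∀ x : G ⧸ H,
      Integrable (fun h : H => u ((h : G) • x)) (haarProb H) := fun hu x =>
    (hu.comp (by fun_prop : Continuous fun h : H => (h : G) • x)).integrable_of_hasCompactSupport
      (HasCompactSupport.of_compactSpace _)
  ext x
  exact integral_add (h hf x) (h hg x)

theorem leftAverageDiv_add {f g : G ⧸ H → ℂ} (hf : Continuous f) (hg : Continuous g)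
    (y x : G ⧸ H) :
    leftAverageDiv H (f + g) y x = leftAverageDiv H f y x + leftAverageDiv H g y x := by
  induction y using QuotientGroup.induction_on with
  | H a => simp only [leftAverageDiv_mk, leftAverage_add hf hg, Pi.add_apply]

theorem leftAverageDiv_smul (c : ℂ) (f : G ⧸ H → ℂ) (y x : G ⧸ H) :
    leftAverageDiv H (c • f) y x = c • leftAverageDiv H f y x := by
  induction y using QuotientGroup.induction_on with
  | H a => exact integral_smul c fun h : H => f ((h : G) • a⁻¹ • x)

theorem continuous_convIntegrand (f g : C_c(G ⧸ H, ℂ)) :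
    Continuous fun p : (G ⧸ H) × (G ⧸ H) => f p.1 * leftAverageDiv H g p.1 p.2 :=
  (f.continuous.comp continuous_fst).mul (continuous_leftAverageDiv g.continuous)

theorem hasCompactSupport_convIntegrand [T2Space G] (f g : C_c(G ⧸ H, ℂ)) :
    HasCompactSupport fun p : (G ⧸ H) × (G ⧸ H) => f p.1 * leftAverageDiv H g p.1 p.2 := by
  obtain ⟨M, hM, h⟩ :=
    exists_isCompact_leftAverageDiv_eq_zero g.hasCompactSupport f.hasCompactSupport
  refine HasCompactSupport.intro (f.hasCompactSupport.prod hM) fun p hp => ?_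
  by_cases h1 : p.1 ∈ tsupport f
  · rw [h p.1 h1 p.2 fun h2 => hp ⟨h1, h2⟩, mul_zero]
  · rw [image_eq_zero_of_notMem_tsupport h1, zero_mul]

end CosetFunctions

/-! ### Convolution on `C_c` and its `L¹` bound -/

section Conv

variable {G : Type*} [Group G] [TopologicalSpace G] [IsTopologicalGroup G]
  [MeasurableSpace G] [BorelSpace G]
  {H : Subgroup G} [CompactSpace H] [MeasurableSpace (G ⧸ H)] [BorelSpace (G ⧸ H)]
  (μ : Measure (G ⧸ H)) [IsFiniteMeasureOnCompacts μ]

theorem integrable_convIntegrand (f g : C_c(G ⧸ H, ℂ)) (x : G ⧸ H) :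
    Integrable (fun y => f y * leftAverageDiv H g y x) μ := by
  refine Continuous.integrable_of_hasCompactSupport
    ((continuous_convIntegrand f g).comp (by fun_prop : Continuous fun y => (y, x))) ?_
  exact f.hasCompactSupport.mul_right

variable [T2Space G]

/-- The convolution of `C_c` functions, as an element of `C_c`. -/
def compactlySupportedConv (f g : C_c(G ⧸ H, ℂ)) : C_c(G ⧸ H, ℂ) where
  toFun := cosetConv H μ f g
  continuous_toFun := by
    rw [← continuousOn_univ]
    refine continuousOn_integral_of_compact_support f.hasCompactSupport
      ((continuous_convIntegrand f g).comp continuous_swap).continuousOn fun x y _ hy => ?_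
    rw [image_eq_zero_of_notMem_tsupport hy, zero_mul]
  hasCompactSupport' := by
    obtain ⟨M, hM, h⟩ :=
      exists_isCompact_leftAverageDiv_eq_zero g.hasCompactSupport f.hasCompactSupport
    refine HasCompactSupport.intro hM fun x hx => ?_
    refine integral_eq_zero_of_ae (ae_of_all _ fun y => ?_)
    by_cases hy : y ∈ tsupport f
    · simp [h y hy x hx]
    · simp [image_eq_zero_of_notMem_tsupport hy]

theorem compactlySupportedConv_apply (f g : C_c(G ⧸ H, ℂ)) (x : G ⧸ H) :
    compactlySupportedConv μ f g x = ∫ y, f y * leftAverageDiv H g y x ∂μ := rfl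

/-- The convolution of `C_c` functions, as a bilinear map. -/
def compactlySupportedConvₗ : C_c(G ⧸ H, ℂ) →ₗ[ℂ] C_c(G ⧸ H, ℂ) →ₗ[ℂ] C_c(G ⧸ H, ℂ) :=
  LinearMap.mk₂ ℂ (compactlySupportedConv μ)
    (fun f f' g => CompactlySupportedContinuousMap.ext fun x => by
      simp only [compactlySupportedConv_apply, CompactlySupportedContinuousMap.add_apply, add_mul]
      exact integral_add (integrable_convIntegrand μ f g x) (integrable_convIntegrand μ f' g x))
    (fun c f g => CompactlySupportedContinuousMap.ext fun x => by
      simp only [compactlySupportedConv_apply, CompactlySupportedContinuousMap.smul_apply,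
        smul_mul_assoc]
      exact integral_smul _ _)
    (fun f g g' => CompactlySupportedContinuousMap.ext fun x => by
      simp only [compactlySupportedConv_apply, CompactlySupportedContinuousMap.add_apply,
        CompactlySupportedContinuousMap.coe_add]
      refine (integral_congr_ae (ae_of_all _ fun y => ?_)).trans
        (integral_add (integrable_convIntegrand μ f g x) (integrable_convIntegrand μ f g' x))
      exact (congrArg (f y * ·) (leftAverageDiv_add g.continuous g'.continuous y x)).trans
        (mul_add _ _ _))
    (fun c f g => CompactlySupportedContinuousMap.ext fun x => by
      simp only [compactlySupportedConv_apply, CompactlySupportedContinuousMap.smul_apply,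
        CompactlySupportedContinuousMap.coe_smul, leftAverageDiv_smul, mul_smul_comm]
      exact integral_smul _ _)

variable [SMulInvariantMeasure G (G ⧸ H) μ]

/-- Bound the norm of the average by the average of the norm and exchange integrals; invariance of
`μ` makes the inner integral independent of `h`, and `dh` has mass one. -/
theorem integral_norm_leftAverage_le (g : C_c(G ⧸ H, ℂ)) :
    ∫ x, ‖leftAverage H g x‖ ∂μ ≤ ∫ x, ‖g x‖ ∂μ := by
  obtain ⟨M, hM, h⟩ := exists_isCompact_leftAverage_eq_zero g.hasCompactSupport
  have hc : Continuous fun p : (G ⧸ H) × H => ‖g ((p.2 : G) • p.1)‖ := by fun_prop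
  have hs : HasCompactSupport fun p : (G ⧸ H) × H => ‖g ((p.2 : G) • p.1)‖ :=
    HasCompactSupport.intro (hM.prod isCompact_univ) fun p hp => by
      rw [h p.1 (fun h1 => hp ⟨h1, mem_univ _⟩), norm_zero]
  have hJ : HasCompactSupport (leftAverage H g) :=
    HasCompactSupport.intro hM fun x hx => by simp [leftAverage, h x hx]
  have hN : Continuous fun x => ∫ h : H, ‖g ((h : G) • x)‖ ∂(haarProb H) := by
    rw [← continuousOn_univ]
    exact continuousOn_integral_of_compact_support isCompact_univ hc.continuousOn
      fun _ _ _ h => (h (mem_univ _)).elim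
  calc ∫ x, ‖leftAverage H g x‖ ∂μ
      ≤ ∫ x, ∫ h : H, ‖g ((h : G) • x)‖ ∂(haarProb H) ∂μ := by
        refine integral_mono ?_ ?_ fun x => norm_integral_le_integral_norm _
        · exact (continuous_leftAverage g.continuous).norm.integrable_of_hasCompactSupport hJ.norm
        · exact hN.integrable_of_hasCompactSupport
            (HasCompactSupport.intro hM fun x hx => by simp [h x hx])
    _ = ∫ h : H, ∫ x, ‖g ((h : G) • x)‖ ∂μ ∂(haarProb H) :=
        integral_integral_swap_of_hasCompactSupport hc hs
    _ = ∫ x, ‖g x‖ ∂μ := by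
        simp_rw [integral_smul_eq_self (μ := μ) fun x => ‖g x‖]
        simp

theorem integral_norm_leftAverageDiv_le (g : C_c(G ⧸ H, ℂ)) (y : G ⧸ H) :
    ∫ x, ‖leftAverageDiv H g y x‖ ∂μ ≤ ∫ x, ‖g x‖ ∂μ := by
  induction y using QuotientGroup.induction_on with
  | H a =>
    simp_rw [leftAverageDiv_mk]
    rw [integral_smul_eq_self (μ := μ) fun x => ‖leftAverage H g x‖]
    exact integral_norm_leftAverage_le μ g

/-- The bound that lets the product extend to `L¹`. After Fubini the inner integral runs over `x`,
where `x ↦ J g(y⁻¹x)` has `L¹` norm at most that of `g`, whatever `y` is. -/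
theorem norm_compactlySupportedConv_le (f g : C_c(G ⧸ H, ℂ)) :
    ‖compactlySupportedToL1 μ (compactlySupportedConvₗ μ f g)‖ ≤
      ‖compactlySupportedToL1 μ f‖ * ‖compactlySupportedToL1 μ g‖ := by
  have hc := (continuous_convIntegrand f g).norm
  have hs := (hasCompactSupport_convIntegrand f g).norm
  simp only [norm_compactlySupportedToL1]
  calc ∫ x, ‖compactlySupportedConv μ f g x‖ ∂μ
      ≤ ∫ x, ∫ y, ‖f y * leftAverageDiv H g y x‖ ∂μ ∂μ := by
        refine integral_mono_of_nonneg (ae_of_all _ fun x => norm_nonneg _) ?_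
          (ae_of_all _ fun x => norm_integral_le_integral_norm _)
        obtain ⟨M, hM, h⟩ :=
          exists_isCompact_leftAverageDiv_eq_zero g.hasCompactSupport f.hasCompactSupport
        refine Continuous.integrable_of_hasCompactSupport ?_
          (HasCompactSupport.intro hM fun x hx => integral_eq_zero_of_ae (ae_of_all _ fun y => ?_))
        · rw [← continuousOn_univ]
          refine continuousOn_integral_of_compact_support f.hasCompactSupport
            (hc.comp continuous_swap).continuousOn fun x y _ hy => ?_
          rw [image_eq_zero_of_notMem_tsupport hy, zero_mul, norm_zero]
        · by_cases hy : y ∈ tsupport f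
          · simp [h y hy x hx]
          · simp [image_eq_zero_of_notMem_tsupport hy]
    _ = ∫ y, ∫ x, ‖f y * leftAverageDiv H g y x‖ ∂μ ∂μ :=
        (integral_integral_swap_of_hasCompactSupport hc hs).symm
    _ ≤ ∫ y, ‖f y‖ * ∫ x, ‖g x‖ ∂μ ∂μ := by
        refine integral_mono_of_nonneg (ae_of_all _ fun y => integral_nonneg fun x => norm_nonneg _)
          (f.integrable.norm.mul_const _) (ae_of_all _ fun y => ?_)
        simp only [norm_mul, integral_const_mul]
        exact mul_le_mul_of_nonneg_left (integral_norm_leftAverageDiv_le μ g y) (norm_nonneg _)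
    _ = (∫ x, ‖f x‖ ∂μ) * ∫ x, ‖g x‖ ∂μ := integral_mul_const _ _

end Conv


/-! ### The adjoint identity and the kernel transform -/

section Kernel

variable {G : Type*} [Group G] [TopologicalSpace G] [IsTopologicalGroup G]
  [MeasurableSpace G] [BorelSpace G]
  {H : Subgroup G} [CompactSpace H] [MeasurableSpace (G ⧸ H)] [BorelSpace (G ⧸ H)]
  (μ : Measure (G ⧸ H)) [IsFiniteMeasureOnCompacts μ]

variable (H) in
/-- `x ↦ ∫_H ψ(xhyH) dh`, as a bounded continuous function. -/
def boundedKernel (ψ : (G ⧸ H) →ᵇ ℂ) (y : G ⧸ H) : (G ⧸ H) →ᵇ ℂ :=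
  BoundedContinuousFunction.ofNormedAddCommGroup (fun x => cosetKernel H ψ x y)
    ((continuous_cosetKernel ψ.continuous).comp (by fun_prop : Continuous fun x => (x, y)))
    ‖ψ‖ fun x => norm_cosetKernel_le ψ.norm_coe_le_norm x y

theorem norm_integral_mul_cosetKernel_le (ψ : (G ⧸ H) →ᵇ ℂ) (f : C_c(G ⧸ H, ℂ)) (y : G ⧸ H) :
    ‖∫ x, f x * cosetKernel H ψ x y ∂μ‖ ≤ ‖ψ‖ * ‖compactlySupportedToL1 μ f‖ := by
  rw [norm_compactlySupportedToL1, mul_comm, ← integral_mul_const]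
  refine norm_integral_le_of_norm_le (f.integrable.norm.mul_const _) (ae_of_all _ fun x => ?_)
  rw [norm_mul]
  exact mul_le_mul_of_nonneg_left (norm_cosetKernel_le ψ.norm_coe_le_norm x y) (norm_nonneg _)

variable [T2Space G]

/-- For `y = aH`, substitute `x ↦ ax`, then `x ↦ h⁻¹x` under the integral over `H`: this strips `g`
of its translation and leaves `ψ(ah⁻¹x)`. Inversion invariance of `dh` replaces `h⁻¹` by `h`. -/
theorem integral_leftAverage_mul [SMulInvariantMeasure G (G ⧸ H) μ] (g : C_c(G ⧸ H, ℂ))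
    {ψ : G ⧸ H → ℂ} (hψ : Continuous ψ) (y : G ⧸ H) :
    ∫ x, leftAverageDiv H g y x * ψ x ∂μ = ∫ x, g x * cosetKernel H ψ y x ∂μ := by
  induction y using QuotientGroup.induction_on with
  | H a =>
    obtain ⟨M, hM, hMg⟩ := exists_isCompact_leftAverage_eq_zero g.hasCompactSupport
    calc ∫ x, leftAverageDiv H g a x * ψ x ∂μ
        = ∫ x, leftAverage H g x * ψ (a • x) ∂μ := by
          rw [← integral_smul_eq_self (μ := μ) _ (g := a)]
          simp [leftAverageDiv_mk]
      _ = ∫ x, ∫ h : H, g ((h : G) • x) * ψ (a • x) ∂(haarProb H) ∂μ := by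
          simp_rw [leftAverage, integral_mul_const]
      _ = ∫ h : H, ∫ x, g ((h : G) • x) * ψ (a • x) ∂μ ∂(haarProb H) := by
          refine integral_integral_swap_of_hasCompactSupport ?_
            (HasCompactSupport.intro (hM.prod isCompact_univ) fun p hp => ?_)
          · unfold Function.uncurry; fun_prop
          · simp [Function.uncurry, hMg p.1 (fun h1 => hp ⟨h1, mem_univ _⟩)]
      _ = ∫ h : H, ∫ x, g x * ψ ((a * (h⁻¹ : H)) • x) ∂μ ∂(haarProb H) := by
          refine integral_congr_ae (ae_of_all _ fun h => ?_)
          simp only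
          rw [← integral_smul_eq_self (μ := μ) _ (g := (h⁻¹ : G))]
          simp [mul_smul]
      _ = ∫ h : H, ∫ x, g x * ψ ((a * h) • x) ∂μ ∂(haarProb H) :=
          integral_inv_eq_self (fun h : H => ∫ x, g x * ψ ((a * h) • x) ∂μ) (haarProb H)
      _ = ∫ x, ∫ h : H, g x * ψ ((a * h) • x) ∂(haarProb H) ∂μ := by
          refine (integral_integral_swap_of_hasCompactSupport ?_
            (HasCompactSupport.intro (g.hasCompactSupport.prod isCompact_univ) fun p hp => ?_)).symm
          · unfold Function.uncurry; fun_prop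
          · simp [Function.uncurry,
              image_eq_zero_of_notMem_tsupport (fun h1 => hp ⟨h1, mem_univ _⟩)]
      _ = ∫ x, g x * cosetKernel H ψ a x ∂μ := by
          simp_rw [cosetKernel_mk, integral_const_mul]

/-- The convolution of `C_c` functions represents the functional that defines the convolution of
the associated measures. -/
theorem integral_cosetConv_mul [SMulInvariantMeasure G (G ⧸ H) μ] (f g : C_c(G ⧸ H, ℂ))
    {ψ : G ⧸ H → ℂ} (hψ : Continuous ψ) :
    ∫ x, cosetConv H μ f g x * ψ x ∂μ = ∫ y, g y * ∫ x, f x * cosetKernel H ψ x y ∂μ ∂μ := by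
  calc ∫ x, cosetConv H μ f g x * ψ x ∂μ
      = ∫ x, ∫ y, f y * leftAverageDiv H g y x * ψ x ∂μ ∂μ := by
        simp_rw [cosetConv, integral_mul_const]
    -- `ψ` is merely continuous; the compact support comes from `f(y) J g(y⁻¹x)`. In the second
    -- exchange it comes from the product of `f` and `g`.
    _ = ∫ y, ∫ x, f y * leftAverageDiv H g y x * ψ x ∂μ ∂μ :=
        (integral_integral_swap_of_hasCompactSupport
          (f := fun y x => f y * leftAverageDiv H g y x * ψ x)
          ((continuous_convIntegrand f g).mul (hψ.comp continuous_snd))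
          (hasCompactSupport_convIntegrand f g).mul_right).symm
    _ = ∫ y, ∫ x, g x * (f y * cosetKernel H ψ y x) ∂μ ∂μ := by
        refine integral_congr_ae (ae_of_all _ fun y => ?_)
        simp only [mul_assoc, integral_const_mul, integral_leftAverage_mul μ g hψ y,
          mul_left_comm (g _)]
    _ = ∫ x, ∫ y, g x * (f y * cosetKernel H ψ y x) ∂μ ∂μ := by
        refine integral_integral_swap_of_hasCompactSupport ?_
          (HasCompactSupport.intro (f.hasCompactSupport.prod g.hasCompactSupport) fun p hp => ?_)
        · exact (g.continuous.comp continuous_snd).mul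
            ((f.continuous.comp continuous_fst).mul (continuous_cosetKernel hψ))
        · by_cases h1 : p.1 ∈ tsupport f
          · simp [Function.uncurry, image_eq_zero_of_notMem_tsupport (fun h2 => hp ⟨h1, h2⟩)]
          · simp [Function.uncurry, image_eq_zero_of_notMem_tsupport h1]
    _ = ∫ y, g y * ∫ x, f x * cosetKernel H ψ x y ∂μ ∂μ := by
        simp_rw [integral_const_mul]

/-- `f ↦ (y ↦ ∫ f(x) ∫_H ψ(xhyH) dh dμ(x))` on `C_c`. -/
def kernelTransformₗ (ψ : (G ⧸ H) →ᵇ ℂ) : C_c(G ⧸ H, ℂ) →ₗ[ℂ] (G ⧸ H) →ᵇ ℂ where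
  toFun f := BoundedContinuousFunction.ofNormedAddCommGroup
    (fun y => ∫ x, f x * cosetKernel H ψ x y ∂μ)
    (by
      rw [← continuousOn_univ]
      refine continuousOn_integral_of_compact_support f.hasCompactSupport ?_ fun y x _ hx => ?_
      · exact ((f.continuous.comp continuous_snd).mul
          ((continuous_cosetKernel ψ.continuous).comp continuous_swap)).continuousOn
      · rw [image_eq_zero_of_notMem_tsupport hx, zero_mul])
    _ (norm_integral_mul_cosetKernel_le μ ψ f)
  map_add' f g := by
    ext y
    refine (integral_congr_ae (ae_of_all _ fun x => add_mul _ _ _)).trans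
      (integral_add (integrable_mul_boundedContinuous μ f.integrable (boundedKernel H ψ y))
        (integrable_mul_boundedContinuous μ g.integrable (boundedKernel H ψ y)))
  map_smul' c f := by
    ext y
    exact (integral_congr_ae (ae_of_all _ fun x => smul_mul_assoc _ _ _)).trans
      (integral_smul c _)

end Kernel

/-! ### Passage from `C_c` to `L¹` -/

section Representation

variable {G : Type*} [Group G] [TopologicalSpace G] [IsTopologicalGroup G]
  [T2Space G] [MeasurableSpace G] [BorelSpace G]
  {H : Subgroup G} [CompactSpace H] [MeasurableSpace (G ⧸ H)] [BorelSpace (G ⧸ H)]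
  (μ : Measure (G ⧸ H)) [μ.Regular]

variable {μ} in
-- Turns the almost-everywhere condition into equations in `L¹`, the form that density arguments
-- use.
theorem extendsConv_iff {B : Lp ℂ 1 μ →L[ℂ] Lp ℂ 1 μ →L[ℂ] Lp ℂ 1 μ} :
    ExtendsConv H μ B ↔ ∀ f g, B (compactlySupportedToL1 μ f) (compactlySupportedToL1 μ g) =
      compactlySupportedToL1 μ (compactlySupportedConvₗ μ f g) := by
  refine ⟨fun h f g => Lp.ext ?_, fun h f g φ ψ hφ hψ => ?_⟩
  · exact (h f g _ _ (coeFn_compactlySupportedToL1 μ f) (coeFn_compactlySupportedToL1 μ g)).trans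
      (coeFn_compactlySupportedToL1 μ (compactlySupportedConvₗ μ f g)).symm
  · obtain rfl : φ = compactlySupportedToL1 μ f :=
      Lp.ext (hφ.trans (coeFn_compactlySupportedToL1 μ f).symm)
    obtain rfl : ψ = compactlySupportedToL1 μ g :=
      Lp.ext (hψ.trans (coeFn_compactlySupportedToL1 μ g).symm)
    rw [h]
    exact coeFn_compactlySupportedToL1 μ _

variable [LocallyCompactSpace G]

/-- `φ ↦ (y ↦ ∫ φ(x) ∫_H ψ(xhyH) dh dμ(x))` on `L¹`. -/
def kernelTransform (ψ : (G ⧸ H) →ᵇ ℂ) : Lp ℂ 1 μ →L[ℂ] (G ⧸ H) →ᵇ ℂ :=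
  (kernelTransformₗ μ ψ).extendOfNorm (compactlySupportedToL1 μ)

theorem kernelTransform_compactlySupportedToL1 (ψ : (G ⧸ H) →ᵇ ℂ) (f : C_c(G ⧸ H, ℂ)) :
    kernelTransform μ ψ (compactlySupportedToL1 μ f) = kernelTransformₗ μ ψ f :=
  LinearMap.extendOfNorm_eq (denseRange_compactlySupportedToL1 μ)
    ⟨‖ψ‖, fun f => BoundedContinuousFunction.norm_ofNormedAddCommGroup_le _ (by positivity)
      (norm_integral_mul_cosetKernel_le μ ψ f)⟩ f

/-- Evaluation at `y` is continuous for the uniform norm, so the formula passes from `C_c` to the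
extension. It shows that the inner integral is bounded and continuous in `y` for every `φ` in `L¹`.
-/
theorem kernelTransform_apply (ψ : (G ⧸ H) →ᵇ ℂ) (φ : Lp ℂ 1 μ) (y : G ⧸ H) :
    kernelTransform μ ψ φ y = boundedPairing μ (boundedKernel H ψ y) φ := by
  have hcont : Continuous fun φ => kernelTransform μ ψ φ y :=
    (continuous_eval_const y).comp (kernelTransform μ ψ).continuous
  refine congrFun ((denseRange_compactlySupportedToL1 μ).equalizer hcont
    (boundedPairing μ (boundedKernel H ψ y)).continuous (funext fun f => ?_)) φ
  simp only [Function.comp_apply]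
  rw [kernelTransform_compactlySupportedToL1, boundedPairing_compactlySupportedToL1]
  rfl

variable [SMulInvariantMeasure G (G ⧸ H) μ]

variable (H) in
theorem existsUnique_extendsConv : ∃! B, ExtendsConv H μ B := by
  obtain ⟨B, hB⟩ := exists_bilinear_extension μ
    ((compactlySupportedConvₗ μ).compr₂ (compactlySupportedToL1 μ))
    (norm_compactlySupportedConv_le μ)
  refine ⟨B, extendsConv_iff.2 hB, fun B' hB' => bilinear_ext fun f g => ?_⟩
  rw [extendsConv_iff.1 hB', hB, LinearMap.compr₂_apply]

variable {μ} in
theorem isMeasureConv_densityMeasure {B : Lp ℂ 1 μ →L[ℂ] Lp ℂ 1 μ →L[ℂ] Lp ℂ 1 μ}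
    (hB : ExtendsConv H μ B) (φ φ' : Lp ℂ 1 μ) :
    IsMeasureConv H (densityMeasure μ φ) (densityMeasure μ φ') (densityMeasure μ (B φ φ')) := by
  intro ψ
  -- Both sides of the defining identity, as continuous bilinear forms in `(φ, φ')`; on `C_c` their
  -- equality is `integral_cosetConv_mul`.
  have key : (ContinuousLinearMap.compL ℂ _ _ _ (boundedPairing μ ψ.toBCF)).comp B =
      (boundedPairing μ).comp (kernelTransform μ ψ.toBCF) := by
    refine bilinear_ext fun f g => ?_
    change boundedPairing μ ψ.toBCF (B _ _) = boundedPairing μ (kernelTransform μ ψ.toBCF _) _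
    rw [extendsConv_iff.1 hB, kernelTransform_compactlySupportedToL1,
      boundedPairing_compactlySupportedToL1, boundedPairing_compactlySupportedToL1]
    exact integral_cosetConv_mul μ f g ψ.continuous
  have hl : cintegral (densityMeasure μ (B φ φ')).1 ψ = boundedPairing μ ψ.toBCF (B φ φ') :=
    cintegral_withDensityᵥ (L1.integrable_coeFn _) ψ.toBCF
  have hr : (fun y => cintegral (densityMeasure μ φ).1 fun x => cosetKernel H ψ x y) =
      kernelTransform μ ψ.toBCF φ := by
    ext y
    rw [kernelTransform_apply]
    exact cintegral_withDensityᵥ (L1.integrable_coeFn φ) (boundedKernel H ψ.toBCF y)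
  rw [hl, hr]
  refine Eq.trans ?_ (cintegral_withDensityᵥ (L1.integrable_coeFn φ') _).symm
  exact congrArg (fun b => b φ φ') key

end Representation

end CosetMeasure

end

theorem mainTheorem8 {G : Type*} [Group G] [TopologicalSpace G] [IsTopologicalGroup G]
    [LocallyCompactSpace G] [T2Space G] [MeasurableSpace G] [BorelSpace G]
    (H : Subgroup G) [CompactSpace H] [MeasurableSpace (G ⧸ H)] [BorelSpace (G ⧸ H)]
    (σ : Measure G) [σ.IsHaarMeasure] [σ.Regular]
    (μ : Measure (G ⧸ H)) [μ.Regular] [SMulInvariantMeasure G (G ⧸ H) μ]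
    (hWeil : ∀ f : C_c(G, ℂ), ∫ x, cosetAverage H f x ∂μ = ∫ x, f x ∂σ) :
    -- the convolutions below are the ones given by their defining properties
    ((∃! B, ExtendsConv H μ B) ∧ ExtendsConv H μ (l1Conv H μ)) ∧
    (∀ φ φ' : Lp ℂ 1 μ,
      (∃! n, IsMeasureConv H (densityMeasure μ φ) (densityMeasure μ φ') n) ∧
      IsMeasureConv H (densityMeasure μ φ) (densityMeasure μ φ')
        (measureConv H (densityMeasure μ φ) (densityMeasure μ φ'))) ∧
    -- the convolution of the measures is the measure of the convolution
    (∀ φ φ' : Lp ℂ 1 μ,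
      measureConv H (densityMeasure μ φ) (densityMeasure μ φ') =
        densityMeasure μ (l1Conv H μ φ φ')) ∧
    -- together with linearity: the map `φ ↦ μ_φ` is a homomorphism of algebras
    IsLinearMap ℂ (fun φ : Lp ℂ 1 μ => densityMeasure μ φ) := by
  have huniq := existsUnique_extendsConv H μ
  have hl1 : ExtendsConv H μ (l1Conv H μ) := by
    rw [l1Conv, dif_pos huniq.exists]
    exact huniq.exists.choose_spec
  have hconv : ∀ φ φ' : Lp ℂ 1 μ, IsMeasureConv H (densityMeasure μ φ) (densityMeasure μ φ')
      (densityMeasure μ (l1Conv H μ φ φ')) := isMeasureConv_densityMeasure hl1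
  have hmeas : ∀ φ φ' : Lp ℂ 1 μ, IsMeasureConv H (densityMeasure μ φ) (densityMeasure μ φ')
      (measureConv H (densityMeasure μ φ) (densityMeasure μ φ')) := fun φ φ' => by
    have hex : ∃ n, IsMeasureConv H (densityMeasure μ φ) (densityMeasure μ φ') n := ⟨_, hconv φ φ'⟩
    rw [measureConv, dif_pos hex]
    exact hex.choose_spec
  -- `measureConv` is a chosen witness; uniqueness identifies it with the density measure of the
  -- `L¹` product.
  have hext : ∀ {l l' n n' : RegularComplexMeasure (G ⧸ H)}, IsMeasureConv H l l' n →
      IsMeasureConv H l l' n' → n = n' := fun h h' =>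
    regularComplexMeasure_ext fun ψ => (h ψ).trans (h' ψ).symm
  exact ⟨⟨huniq, hl1⟩, fun φ φ' => ⟨⟨_, hconv φ φ', fun n hn => hext hn (hconv φ φ')⟩, hmeas φ φ'⟩,
    fun φ φ' => hext (hmeas φ φ') (hconv φ φ'), isLinearMap_densityMeasure μ⟩
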